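/- Theorem. Let $V$ be a finite set of voters and $G=(V,E)$ a directed graph with edge weights $b_{uv}\in[0,1]$, $(u,v)\in E$, such that $\sum_{u:(u,v)\in E} b_{uv}\le 1$ for every $v\in V$. Let $C$ be a set of $m\ge 2$ candidates with a target candidate $c_\star\in C$. Every voter $v$ has a preference list, in which $\pi_v(c)\in\{1,\dots,m\}$ is the position of candidate $c$ ($\pi_v$ is a bijection). Let $\alpha:\{1,\dots,m\}\to[0,1]$ be any function, let $f:\{1,\dots,m\}\to\mathbb N$ be a nonincreasing scoring function, and let $B\in\mathbb N$. Linear Threshold Ranking. Draw thresholds $t_v$, $v\in V$, independently and uniformly from $[0,1]$. Given a set of seeds $A_0\subseteq V$, let $$A_{i+1}=A_i\cup\Big\{v\in V:\ \sum_{u\in A_i,\,(u,v)\in E} b_{uv}\ge t_v\Big\}\qquad(i\ge 0),$$ and let $A$ be the set $A_i$ at the first time $i$ with $A_i=A_{i+1}$. In the list of each voter $v$ (seed or not) the target candidate then goes up by $$\pi^{\uparrow}_v(c_\star)=\min\Big(\pi_v(c_\star)-1,\ \Big\lfloor \frac{\alpha(\pi_v(c_\star))}{t_v}\sum_{u\in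 A,\,(u,v)\in E} b_{uv}\Big\rfloor\Big)$$ positions, each candidate that it overtakes goes down by one position, and all other candidates keep their position; let $\tilde\pi_v$ denote the new positions. Let $$\mu(\emptyset)=\max_{c\ne c_\star}\sum_{v\in V} f(\pi_v(c))-\sum_{v\in V} f(\pi_v(c_\star)),\qquad \mu(A_0)=\max_{c\ne c_\star}\sum_{v\in V} f(\tilde\pi_v(c))-\sum_{v\in V} f(\tilde\pi_v(c_\star))$$ be the margins before the process and after the process started from $A_0$, let $\mathbb E[\mathrm{MoV}(A_0)]=\mathbb E[\mu(\emptyset)-\mu(A_0)]$ be the expected change in margin, and let $F(A_0)=\mathbb E\big[\sum_{v\in V} f(\tilde\pi_v(c_\star))\big]$ be the expected score of the target candidate. Greedy. Start with $S=\emptyset$. As long as $|S|<B$ and $S\ne V$, choose some $v\in V\setminus S$ that maximizes $F(S\cup\{v\})-F(S)$ (ties are broken arbitrarily) and replace $S$ by $S\cup\{v\}$. Output $S$. Then Greedy has at least one possible output, and every possible output $S$ of Greedy satisfies $|S|\le B$ and $$\mathbb E[\mathrm{MoV}(S)]\ \ge\ \frac13\Big(1-\frac1e\Big)\,\max_{A_0\subseteq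 V,\ |A_0|\le B}\mathbb E[\mathrm{MoV}(A_0)].$$ That is, Greedy run on $F$ is a $\frac13(1-\frac1e)$-approximation algorithm for constructive election control. -/

import Mathlib

open MeasureTheory

/-- A directed influence graph on the voters `V`: a finite set of directed edges, where `(u, v)` is
an edge from `u` to `v`, with weights in `[0, 1]` such that the weights of the edges entering any
node sum to at most one. The values of `weight` outside `edges` play no role. -/
structure InfluenceGraph (V : Type*) [Fintype V] [DecidableEq V] where
  edges : Finset (V × V)
  weight : V → V → ℝ
  weight_mem : ∀ u v, (u, v) ∈ edges → weight u v ∈ Set.Icc (0 : ℝ) 1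
  sum_weight_le_one : ∀ v, ∑ u : V with (u, v) ∈ edges, weight u v ≤ 1

/-- An election on a social network. With `m` the number of candidates, positions in a preference
list are elements of `Fin m`, so position `r ∈ {1, …, m}` of the usual numbering is the element of
value `r - 1`, and the first place is `0`.
`pref v c` is the position of candidate `c` in the list of voter `v`, `rate` is the function `α`,
and `scoring` is the nonincreasing scoring function `f`. -/
structure Election (V C : Type*) [Fintype V] [DecidableEq V] [Fintype C] where
  graph : InfluenceGraph V
  pref : V → C ≃ Fin (Fintype.card C)
  target : C
  rate : Fin (Fintype.card C) → ℝ
  rate_mem : ∀ r, rate r ∈ Set.Icc (0 : ℝ) 1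
  scoring : Fin (Fintype.card C) → ℕ
  scoring_antitone : Antitone scoring

/-- The law of the thresholds: independent and uniform on `[0, 1]`. -/
noncomputable def thresholdLaw (V : Type*) [Fintype V] : Measure (V → ℝ) :=
  Measure.pi fun _ => volume.restrict (Set.Icc (0 : ℝ) 1)

namespace InfluenceGraph

variable {V : Type*} [Fintype V] [DecidableEq V] (G : InfluenceGraph V)

/-- Total weight of the edges entering `v` from the set `A`. -/
noncomputable def influence (A : Finset V) (v : V) : ℝ :=
  ∑ u ∈ A with (u, v) ∈ G.edges, G.weight u v

open Classical in
/-- One round of the Linear Threshold Model with thresholds `t`. -/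
noncomputable def step (t : V → ℝ) (A : Finset V) : Finset V :=
  A ∪ Finset.univ.filter fun v => t v ≤ G.influence A v

/-- The nodes active at time `n` when `A₀` is the set of seeds. -/
noncomputable def activeAt (t : V → ℝ) (A₀ : Finset V) : ℕ → Finset V
  | 0 => A₀
  | n + 1 => G.step t (activeAt t A₀ n)

theorem exists_quiesced (t : V → ℝ) (A₀ : Finset V) :
    ∃ n, G.activeAt t A₀ n = G.activeAt t A₀ (n + 1) := by
  have hmono : Monotone (G.activeAt t A₀) :=
    monotone_nat_of_le_succ fun n => by
      rw [activeAt, step]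
      exact Finset.subset_union_left
  obtain ⟨n, hn⟩ := WellFoundedGT.monotone_chain_condition ⟨G.activeAt t A₀, hmono⟩
  exact ⟨n, hn (n + 1) (Nat.le_succ n)⟩

open Classical in
/-- The set of active nodes at the first time at which the process has quiesced. -/
noncomputable def finalActive (t : V → ℝ) (A₀ : Finset V) : Finset V :=
  G.activeAt t A₀ (Nat.find (G.exists_quiesced t A₀))

end InfluenceGraph

namespace Election

variable {V C : Type*} [Fintype V] [DecidableEq V] [Fintype C] [DecidableEq C] (P : Election V C)

/-- The number of positions that the target candidate goes up in the list of `v`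
(thresholds equal to zero, for which the quotient is a convention, have probability zero). -/
noncomputable def shiftUp (t : V → ℝ) (A₀ : Finset V) (v : V) : ℕ :=
  min (P.pref v P.target : ℕ)
    ⌊P.rate (P.pref v P.target) / t v * P.graph.influence (P.graph.finalActive t A₀) v⌋₊

/-- The position of the target candidate in the list of `v` after the process. -/
noncomputable def newTargetPos (t : V → ℝ) (A₀ : Finset V) (v : V) : Fin (Fintype.card C) :=
  ⟨(P.pref v P.target : ℕ) - P.shiftUp t A₀ v,
    lt_of_le_of_lt (Nat.sub_le _ _) (P.pref v P.target).isLt⟩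

/-- The position of candidate `c` in the list of `v` after the process: the candidates overtaken by
the target candidate shift one position down, and the others keep their position. -/
noncomputable def newPos (t : V → ℝ) (A₀ : Finset V) (v : V) (c : C) : Fin (Fintype.card C) :=
  if c = P.target then P.newTargetPos t A₀ v
  else if h : P.newTargetPos t A₀ v ≤ P.pref v c ∧ P.pref v c < P.pref v P.target then
    ⟨(P.pref v c : ℕ) + 1, lt_of_le_of_lt (Nat.succ_le_of_lt h.2) (P.pref v P.target).isLt⟩
  else P.pref v c

/-- The score of candidate `c` when `pos v c` is the position of `c` in the list of `v`. -/
def score (pos : V → C → Fin (Fintype.card C)) (c : C) : ℕ :=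
  ∑ v, P.scoring (pos v c)

/-- The margin: the highest score of a candidate other than the target, minus the score of the
target. -/
def margin (pos : V → C → Fin (Fintype.card C)) : ℤ :=
  (((Finset.univ.erase P.target).sup (P.score pos) : ℕ) : ℤ) - (P.score pos P.target : ℤ)

/-- The change in margin caused by the seeds `A₀` when the thresholds are `t`. -/
noncomputable def mov (t : V → ℝ) (A₀ : Finset V) : ℤ :=
  P.margin (fun v c => P.pref v c) - P.margin (P.newPos t A₀)

/-- The expected change in margin. -/
noncomputable def expectedMov (A₀ : Finset V) : ℝ :=
  ∫ t, (P.mov t A₀ : ℝ) ∂(thresholdLaw V)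

/-- The expected score of the target candidate after the process started from `A₀`. -/
noncomputable def expectedScore (A₀ : Finset V) : ℝ :=
  ∫ t, (P.score (P.newPos t A₀) P.target : ℝ) ∂(thresholdLaw V)

end Election

/-- The sets that the greedy algorithm for the set function `F` and the budget `B` can hold at some
moment: it starts from the empty set and, as long as fewer than `B` nodes are chosen, adds a node of
maximal marginal gain among the nodes that are not yet chosen. Ties are broken arbitrarily. -/
inductive GreedyState {V : Type*} [DecidableEq V] (F : Finset V → ℝ) (B : ℕ) : Finset V → Prop
  | start : GreedyState F B ∅
  | add_node (A : Finset V) (v : V) : GreedyState F B A → A.card < B → v ∉ A →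
      (∀ w, w ∉ A → F (insert w A) - F A ≤ F (insert v A) - F A) →
      GreedyState F B (insert v A)

/-- `A` is a possible output of the greedy algorithm: it stops when `B` nodes are chosen, or when no
node is left. -/
def IsGreedyOutput {V : Type*} [Fintype V] [DecidableEq V] (F : Finset V → ℝ) (B : ℕ)
    (A : Finset V) : Prop :=
  GreedyState F B A ∧ (A.card = B ∨ A = Finset.univ)

/-! The proof rests on two facts: the expected score $F$ of the target is monotone submodular, and
the expected change in margin lies between the target's expected score gain and twice that gain.
Greedy captures a fraction $1-1/e$ of the best gain; the factor two costs $1/2$, which the constant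
$1/3$ absorbs.

For submodularity, telescoping the score along the target's climb writes $F$ as a constant plus
nonnegative multiples of the probabilities of $t_v \le \beta\cdot(\text{final influence on } v)$,
with $\beta=\alpha/(j+1)\in[0,1]$. This is more than the activation of $v$, because $t_v$ also
drives the process. With the other thresholds fixed, let $p_1\subseteq p_2$ be the final active sets
when $v$ is never activated, respectively always activated, from outside. Integrating out $t_v$
leaves $\min(I(p_1),\beta I(p_2))$ if $v$ is not a seed, and $\beta I(p_2)$ if it is, where $I$ is
the influence on $v$ (`real_setOf_le_mul_influence`).

The joint law of $(p_1,p_2)$ depends only on the activation probabilities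
(`IsRandomRule.integral_closurePair_eq`), so the thresholds of the other nodes can be traded for
live edges. Live-edge rules are additive, and then the conditional probability is monotone
submodular for every sample (`isMonotoneSubmodular_conditionalProb`). -/

/-! ### Monotone submodular functions and the greedy algorithm. -/

/-- A monotone set function with diminishing marginal gains. -/
structure IsMonotoneSubmodular {V : Type*} [DecidableEq V] (F : Finset V → ℝ) : Prop where
  mono : Monotone F
  insert_sub_le : ∀ ⦃A B : Finset V⦄, A ⊆ B → ∀ u, F (insert u B) - F B ≤ F (insert u A) - F A

namespace IsMonotoneSubmodular

variable {V : Type*} [DecidableEq V] {F G : Finset V → ℝ}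

theorem add (hF : IsMonotoneSubmodular F) (hG : IsMonotoneSubmodular G) :
    IsMonotoneSubmodular fun A => F A + G A where
  mono := hF.mono.add hG.mono
  insert_sub_le A B h u := by
    linarith [hF.insert_sub_le h u, hG.insert_sub_le h u]

theorem const_mul (hF : IsMonotoneSubmodular F) {c : ℝ} (hc : 0 ≤ c) :
    IsMonotoneSubmodular fun A => c * F A where
  mono := hF.mono.const_mul hc
  insert_sub_le A B h u := by
    simpa only [mul_sub] using mul_le_mul_of_nonneg_left (hF.insert_sub_le h u) hc

theorem const (c : ℝ) : IsMonotoneSubmodular fun _ : Finset V => c where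
  mono := monotone_const
  insert_sub_le _ _ _ _ := le_rfl

theorem sum {ι : Type*} (s : Finset ι) {F : ι → Finset V → ℝ}
    (hF : ∀ i ∈ s, IsMonotoneSubmodular (F i)) : IsMonotoneSubmodular fun A => ∑ i ∈ s, F i A where
  mono _ _ h := Finset.sum_le_sum fun i hi => (hF i hi).mono h
  insert_sub_le A B h u := by
    simp only [← Finset.sum_sub_distrib]
    exact Finset.sum_le_sum fun i hi => (hF i hi).insert_sub_le h u

theorem min_const (hF : IsMonotoneSubmodular F) (c : ℝ) :
    IsMonotoneSubmodular fun A => min (F A) c where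
  mono _ _ h := min_le_min_right c (hF.mono h)
  insert_sub_le A B h u := by
    have h1 := hF.insert_sub_le h u
    have h2 := hF.mono h
    have h3 := hF.mono (Finset.subset_insert u A)
    have h4 := hF.mono (Finset.subset_insert u B)
    have h5 := hF.mono (Finset.insert_subset_insert u h)
    rcases le_total (F A) c with a | a <;> rcases le_total (F B) c with b | b <;>
    rcases le_total (F (insert u A)) c with a' | a' <;>
    rcases le_total (F (insert u B)) c with b' | b' <;>
    simp only [min_eq_left, min_eq_right, a, b, a', b'] <;> linarith

/-- A weighted coverage function is monotone and submodular. -/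
theorem coverage {W : Type*} [DecidableEq W] {X : Finset V → Finset W}
    (hX : ∀ A B, X (A ∪ B) = X A ∪ X B) {w : W → ℝ} (hw : ∀ y, 0 ≤ w y) :
    IsMonotoneSubmodular fun A => ∑ y ∈ X A, w y := by
  have hmono : Monotone X := fun A B h => by
    rw [← Finset.union_eq_right.2 h, hX]
    exact Finset.subset_union_left
  have hins : ∀ A u, ∑ y ∈ X (insert u A), w y - ∑ y ∈ X A, w y = ∑ y ∈ X {u} \ X A, w y := by
    intro A u
    rw [Finset.insert_eq, hX, Finset.union_comm, ← Finset.union_sdiff_self_eq_union,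
      Finset.sum_union Finset.disjoint_sdiff]
    ring
  refine ⟨fun A B h => Finset.sum_le_sum_of_subset_of_nonneg (hmono h) fun y _ _ => hw y, ?_⟩
  intro A B h u
  rw [hins, hins]
  exact Finset.sum_le_sum_of_subset_of_nonneg (Finset.sdiff_subset_sdiff le_rfl (hmono h))
    fun y _ _ => hw y

theorem integral {Ω : Type*} [MeasurableSpace Ω] {μ : Measure Ω} {F : Ω → Finset V → ℝ}
    (hF : ∀ ω, IsMonotoneSubmodular (F ω)) (hi : ∀ A, Integrable (fun ω => F ω A) μ) :
    IsMonotoneSubmodular fun A => ∫ ω, F ω A ∂μ where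
  mono A B h := integral_mono (hi A) (hi B) fun ω => (hF ω).mono h
  insert_sub_le A B h u := by
    rw [← integral_sub (hi _) (hi _), ← integral_sub (hi _) (hi _)]
    exact integral_mono ((hi _).sub (hi _)) ((hi _).sub (hi _)) fun ω => (hF ω).insert_sub_le h u

theorem union_sub_le (hF : IsMonotoneSubmodular F) (A O : Finset V) :
    F (A ∪ O) - F A ≤ ∑ u ∈ O, (F (insert u A) - F A) := by
  induction O using Finset.induction_on with
  | empty => simp
  | insert u O hu ih =>
    rw [Finset.sum_insert hu, Finset.union_insert]
    linarith [hF.insert_sub_le (Finset.subset_union_left (s₁ := A) (s₂ := O)) u]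

/-- Each greedy step shrinks the gap to `O` by the factor `1 - 1 / B`: adding all of `O` would close
the gap, and by submodularity this gains at most `B` times the best single marginal gain. -/
theorem greedyState_le (hF : IsMonotoneSubmodular F) {B : ℕ} {O A : Finset V} (hO : O.card ≤ B)
    (hA : GreedyState F B A) :
    F O - F A ≤ (1 - 1 / (B : ℝ)) ^ A.card * (F O - F ∅) := by
  induction hA with
  | start => simp
  | add_node A v _ hlt hv hmax ih =>
    have hB : (1 : ℝ) ≤ B := by exact_mod_cast Nat.one_le_of_lt hlt
    have hgain : 0 ≤ F (insert v A) - F A := sub_nonneg.2 (hF.mono (Finset.subset_insert v A))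
    have hstep : F O - F A ≤ B * (F (insert v A) - F A) :=
      calc F O - F A ≤ F (A ∪ O) - F A := by
            linarith [hF.mono (Finset.subset_union_right (s₁ := A) (s₂ := O))]
        _ ≤ ∑ u ∈ O, (F (insert u A) - F A) := hF.union_sub_le A O
        _ ≤ ∑ _u ∈ O, (F (insert v A) - F A) := by
            refine Finset.sum_le_sum fun u _ => ?_
            by_cases hu : u ∈ A
            · rwa [Finset.insert_eq_self.2 hu, sub_self]
            · exact hmax u hu
        _ = O.card * (F (insert v A) - F A) := by rw [Finset.sum_const, nsmul_eq_mul]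
        _ ≤ B * (F (insert v A) - F A) :=
            mul_le_mul_of_nonneg_right (by exact_mod_cast hO) hgain
    have hdiv : 1 / (B : ℝ) * (F O - F A) ≤ F (insert v A) - F A := by
      rw [one_div, inv_mul_le_iff₀ (by linarith)]
      exact hstep
    have hq : 0 ≤ 1 - 1 / (B : ℝ) := by
      rw [sub_nonneg, div_le_one (by linarith)]
      exact hB
    rw [Finset.card_insert_of_notMem hv, pow_succ']
    calc F O - F (insert v A) ≤ (1 - 1 / (B : ℝ)) * (F O - F A) := by linarith
      _ ≤ (1 - 1 / (B : ℝ)) * ((1 - 1 / (B : ℝ)) ^ A.card * (F O - F ∅)) :=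
          mul_le_mul_of_nonneg_left ih hq
      _ = _ := by ring

/-- The greedy algorithm gains at least the fraction `1 - 1 / e` of the best possible gain. -/
theorem greedy_approximation [Fintype V] (hF : IsMonotoneSubmodular F) {B : ℕ} {O A : Finset V}
    (hO : O.card ≤ B) (hA : IsGreedyOutput F B A) :
    (1 - 1 / Real.exp 1) * (F O - F ∅) ≤ F A - F ∅ := by
  have hgain : 0 ≤ F O - F ∅ := sub_nonneg.2 (hF.mono (Finset.empty_subset O))
  rcases hA.2 with hcard | rfl
  · have h := hF.greedyState_le hO hA.1
    rw [hcard] at h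
    -- For `B = 0` the power is `1` and the bound fails, but then `O` is empty and there is nothing
    -- to gain.
    have hpow : (1 - 1 / (B : ℝ)) ^ B ≤ 1 / Real.exp 1 ∨ O = ∅ := by
      rcases Nat.eq_zero_or_pos B with rfl | hB
      · exact Or.inr (Finset.card_eq_zero.1 (Nat.le_zero.1 hO))
      · left
        rw [one_div (Real.exp 1), ← Real.exp_neg]
        exact Real.one_sub_div_pow_le_exp_neg (by exact_mod_cast hB)
    rcases hpow with hpow | rfl
    · linarith [mul_le_mul_of_nonneg_right hpow hgain]
    · rw [sub_self, mul_zero]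
      exact sub_nonneg.2 (hF.mono (Finset.empty_subset A))
  · have h1 : F O ≤ F Finset.univ := hF.mono (Finset.subset_univ O)
    have h2 : 0 ≤ 1 / Real.exp 1 := by positivity
    linarith [mul_nonneg h2 hgain]

end IsMonotoneSubmodular

theorem GreedyState.card_le {V : Type*} [DecidableEq V] {F : Finset V → ℝ} {B : ℕ} {A : Finset V}
    (h : GreedyState F B A) : A.card ≤ B := by
  cases h with
  | start => simp
  | add_node A v _ hlt hv _ =>
    rw [Finset.card_insert_of_notMem hv]
    exact hlt

theorem exists_isGreedyOutput {V : Type*} [Fintype V] [DecidableEq V] (F : Finset V → ℝ) (B : ℕ) :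
    ∃ A, IsGreedyOutput F B A := by
  classical
  -- A reachable state of maximal cardinality must be terminal, since otherwise one more greedy step
  -- would enlarge it.
  obtain ⟨A, hA, hmax⟩ := Finset.exists_max_image (Finset.univ.filter (GreedyState F B))
    Finset.card ⟨∅, by simpa using GreedyState.start⟩
  rw [Finset.mem_filter] at hA
  refine ⟨A, hA.2, ?_⟩
  by_contra! hne
  have hcompl : Aᶜ.Nonempty := by
    rw [Finset.nonempty_iff_ne_empty, Ne, Finset.compl_eq_empty_iff]
    exact hne.2
  obtain ⟨v, hv, hvmax⟩ := Finset.exists_max_image Aᶜ (fun v => F (insert v A) - F A) hcompl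
  rw [Finset.mem_compl] at hv
  have hnew : GreedyState F B (insert v A) :=
    .add_node A v hA.2 (lt_of_le_of_ne hA.2.card_le hne.1) hv fun w hw =>
      hvmax w (Finset.mem_compl.2 hw)
  have := hmax _ (Finset.mem_filter.2 ⟨Finset.mem_univ _, hnew⟩)
  rw [Finset.card_insert_of_notMem hv] at this
  omega

/-! ### Closures under activation rules. -/

/-- The smallest superset of `A` that contains every node that its rule activates:
`ρ x S` says that `x` becomes active when the nodes of `S` are active. -/
noncomputable def activationClosure {V : Type*} [Fintype V] (ρ : V → Finset V → Prop)
    (A : Finset V) : Finset V := by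
  classical
  exact {x | ∀ S, A ⊆ S → (∀ y, ρ y S → y ∈ S) → x ∈ S}

theorem monotone_update_rule {V : Type*} [DecidableEq V] {ρ : V → Finset V → Prop}
    (hρ : ∀ y, Monotone (ρ y)) {x : V} {r : Finset V → Prop}
    (hr : Monotone r) (y : V) : Monotone (Function.update ρ x r y) := by
  rcases eq_or_ne y x with rfl | h
  · rwa [Function.update_self]
  · rw [Function.update_of_ne h]
    exact hρ y

theorem update_rule_le {V : Type*} [DecidableEq V] {ρ : V → Finset V → Prop}
    {x : V} {r r' : Finset V → Prop} (h : ∀ S, r S → r' S) (y : V)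
    (S : Finset V) (hy : Function.update ρ x r y S) : Function.update ρ x r' y S := by
  rcases eq_or_ne y x with rfl | hne
  · rw [Function.update_self] at hy ⊢
    exact h S hy
  · rwa [Function.update_of_ne hne] at hy ⊢

section ActivationClosure

variable {V : Type*} [Fintype V] {ρ ρ' : V → Finset V → Prop} {A B S : Finset V}

theorem mem_activationClosure {x : V} :
    x ∈ activationClosure ρ A ↔ ∀ S, A ⊆ S → (∀ y, ρ y S → y ∈ S) → x ∈ S := by
  simp [activationClosure]

theorem activationClosure_subset (hA : A ⊆ S) (hS : ∀ y, ρ y S → y ∈ S) :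
    activationClosure ρ A ⊆ S :=
  fun _ hx => mem_activationClosure.1 hx S hA hS

theorem subset_activationClosure : A ⊆ activationClosure ρ A :=
  fun _ hx => mem_activationClosure.2 fun _ hA _ => hA hx

theorem activationClosure_closed (hρ : ∀ y, Monotone (ρ y)) (y : V)
    (hy : ρ y (activationClosure ρ A)) : y ∈ activationClosure ρ A :=
  mem_activationClosure.2 fun _ hA hS => hS y (hρ y (activationClosure_subset hA hS) hy)

theorem activationClosure_mono (hρ : ∀ y S, ρ y S → ρ' y S) (h : A ⊆ B) :
    activationClosure ρ A ⊆ activationClosure ρ' B :=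
  fun _ hx => mem_activationClosure.2 fun S hB hS =>
    mem_activationClosure.1 hx S (h.trans hB) fun y hy => hS y (hρ y S hy)

variable [DecidableEq V]

theorem mem_activationClosure_update_top (x : V) :
    x ∈ activationClosure (Function.update ρ x ⊤) A :=
  mem_activationClosure.2 fun S _ hS => hS x (by simp)

/-- The closure depends on the rule of a single node only through its value at the closure in which
that node is not activated. -/
theorem activationClosure_update (hρ : ∀ y, Monotone (ρ y)) (x : V) {r : Finset V → Prop}
    (hr : Monotone r) [Decidable (r (activationClosure (Function.update ρ x ⊥) A))] :
    activationClosure (Function.update ρ x r) A =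
      if r (activationClosure (Function.update ρ x ⊥) A) then
        activationClosure (Function.update ρ x ⊤) A
      else activationClosure (Function.update ρ x ⊥) A := by
  have hsub : activationClosure (Function.update ρ x ⊥) A ⊆
      activationClosure (Function.update ρ x r) A :=
    activationClosure_mono (update_rule_le fun _ h => h.elim) le_rfl
  split_ifs with h
  · refine (activationClosure_mono (update_rule_le fun _ _ => trivial) le_rfl).antisymm
      (activationClosure_subset subset_activationClosure fun y hy => ?_)
    -- The closure for `r` contains the one with `x` blocked, so by monotonicity `r` still holds
    -- there and `x` belongs to it.
    refine activationClosure_closed (monotone_update_rule hρ hr) y ?_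
    rcases eq_or_ne y x with rfl | hne
    · rw [Function.update_self]
      exact hr hsub h
    · rwa [Function.update_of_ne hne] at hy ⊢
  · refine Finset.Subset.antisymm
      (activationClosure_subset subset_activationClosure fun y hy => ?_) hsub
    rcases eq_or_ne y x with rfl | hne
    · rw [Function.update_self] at hy
      exact absurd hy h
    · refine activationClosure_closed (monotone_update_rule hρ monotone_const) y ?_
      rwa [Function.update_of_ne hne] at hy ⊢

/-- For additive rules the closure is additive. -/
theorem activationClosure_union (hρ : ∀ y A B, ρ y (A ∪ B) ↔ ρ y A ∨ ρ y B) (A B : Finset V) :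
    activationClosure ρ (A ∪ B) = activationClosure ρ A ∪ activationClosure ρ B := by
  have hmono : ∀ y, Monotone (ρ y) := fun y S T h hS => by
    rw [← Finset.union_eq_right.2 h]
    exact (hρ y S T).2 (Or.inl hS)
  refine (activationClosure_subset
    (Finset.union_subset_union subset_activationClosure subset_activationClosure)
    fun y hy => ?_).antisymm (Finset.union_subset
      (activationClosure_mono (fun _ _ => id) Finset.subset_union_left)
      (activationClosure_mono (fun _ _ => id) Finset.subset_union_right))
  rw [Finset.mem_union]
  exact ((hρ y _ _).1 hy).imp (activationClosure_closed hmono y) (activationClosure_closed hmono y)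

/-- An additive rule needs only one of two sources: every activation can be traced either to the
seeds without help from `v`, or to `v` alone. The second part does not depend on `A`. -/
theorem activationClosure_update_top_eq_union (hρ : ∀ y A B, ρ y (A ∪ B) ↔ ρ y A ∨ ρ y B) (v : V)
    (A : Finset V) :
    activationClosure (Function.update ρ v ⊤) A =
      activationClosure (Function.update ρ v ⊥) A ∪
        activationClosure (Function.update ρ v ⊤) ∅ := by
  have hmono : ∀ y, Monotone (ρ y) := fun y S T h hS => by
    rw [← Finset.union_eq_right.2 h]
    exact (hρ y S T).2 (Or.inl hS)
  refine (activationClosure_subset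
    (subset_activationClosure.trans Finset.subset_union_left)
    fun y hy => ?_).antisymm (Finset.union_subset
      (activationClosure_mono (update_rule_le fun _ _ => trivial) le_rfl)
      (activationClosure_mono (fun _ _ => id) (Finset.empty_subset A)))
  rw [Finset.mem_union]
  rcases eq_or_ne y v with rfl | hne
  · exact Or.inr (mem_activationClosure_update_top y)
  · rw [Function.update_of_ne hne, hρ] at hy
    refine hy.imp (fun h => ?_) fun h => ?_
    · refine activationClosure_closed (monotone_update_rule hmono monotone_const) y ?_
      rwa [Function.update_of_ne hne]
    · refine activationClosure_closed (monotone_update_rule hmono monotone_const) y ?_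
      rwa [Function.update_of_ne hne]

end ActivationClosure

/-! ### The Linear Threshold process as a closure. -/

namespace InfluenceGraph

variable {V : Type*} [Fintype V] [DecidableEq V] (G : InfluenceGraph V)

/-- The weight of the edge from `u` to `v`, and zero if there is no edge. -/
noncomputable def edgeWeight (u v : V) : ℝ :=
  if (u, v) ∈ G.edges then G.weight u v else 0

theorem edgeWeight_nonneg (u v : V) : 0 ≤ G.edgeWeight u v := by
  unfold edgeWeight
  split_ifs with h
  · exact (G.weight_mem u v h).1
  · exact le_rfl

theorem influence_eq_sum (A : Finset V) (v : V) :
    G.influence A v = ∑ u ∈ A, G.edgeWeight u v := by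
  rw [influence, Finset.sum_filter]
  rfl

theorem influence_mono {A B : Finset V} (h : A ⊆ B) (v : V) : G.influence A v ≤ G.influence B v := by
  rw [influence_eq_sum, influence_eq_sum]
  exact Finset.sum_le_sum_of_subset_of_nonneg h fun u _ _ => G.edgeWeight_nonneg u v

theorem influence_nonneg (A : Finset V) (v : V) : 0 ≤ G.influence A v := by
  rw [influence_eq_sum]
  exact Finset.sum_nonneg fun u _ => G.edgeWeight_nonneg u v

theorem influence_le_one (A : Finset V) (v : V) : G.influence A v ≤ 1 :=
  (G.influence_mono (Finset.subset_univ A) v).trans (G.sum_weight_le_one v)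

/-- The activation rule of the Linear Threshold Model with thresholds `t`. -/
def thresholdRule (t : V → ℝ) (v : V) (A : Finset V) : Prop :=
  t v ≤ G.influence A v

theorem thresholdRule_mono (t : V → ℝ) (v : V) : Monotone (G.thresholdRule t v) :=
  fun _ _ h hA => le_trans (b := G.influence _ v) hA (G.influence_mono h v)

theorem finalActive_eq_activationClosure (t : V → ℝ) (A : Finset V) :
    G.finalActive t A = activationClosure (G.thresholdRule t) A := by
  classical
  have hle : ∀ n, G.activeAt t A n ⊆ activationClosure (G.thresholdRule t) A := by
    intro n
    induction n with
    | zero => exact subset_activationClosure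
    | succ n ih =>
      rw [activeAt, step]
      refine Finset.union_subset ih fun v hv => ?_
      exact activationClosure_closed (G.thresholdRule_mono t) v
        (G.thresholdRule_mono t v ih (Finset.mem_filter.1 hv).2)
  have hsub : ∀ n, A ⊆ G.activeAt t A n := by
    intro n
    induction n with
    | zero => exact le_rfl
    | succ n ih => exact ih.trans Finset.subset_union_left
  refine (hle _).antisymm (activationClosure_subset (hsub _) fun v hv => ?_)
  have hfix : G.finalActive t A = G.step t (G.finalActive t A) :=
    Nat.find_spec (G.exists_quiesced t A)
  change v ∈ G.finalActive t A
  rw [hfix, step]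
  exact Finset.mem_union_right _ (Finset.mem_filter.2 ⟨Finset.mem_univ v, hv⟩)

end InfluenceGraph

/-! ### Integration over the thresholds. -/

/-- The uniform distribution on `[0, 1]`. -/
noncomputable abbrev unitUniform : Measure ℝ :=
  volume.restrict (Set.Icc (0 : ℝ) 1)

instance isProbabilityMeasure_unitUniform : IsProbabilityMeasure unitUniform :=
  ⟨by simp⟩

instance isProbabilityMeasure_thresholdLaw (V : Type*) [Fintype V] :
    IsProbabilityMeasure (thresholdLaw V) := by
  unfold thresholdLaw
  infer_instance

theorem unitUniform_real_setOf_le {m : ℝ} (h0 : 0 ≤ m) (h1 : m ≤ 1) :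
    unitUniform.real {s | s ≤ m} = m := by
  have hset : {s | s ≤ m} ∩ Set.Icc (0 : ℝ) 1 = Set.Icc 0 m := by
    ext s
    simp only [Set.mem_inter_iff, Set.mem_ofPred_eq, Set.mem_Icc]
    exact ⟨fun h => ⟨h.2.1, h.1⟩, fun h => ⟨h.2, h.1, h.2.trans h1⟩⟩
  have hm : MeasurableSet {s : ℝ | s ≤ m} := measurableSet_Iic
  rw [measureReal_restrict_apply hm, hset,
    Real.volume_real_Icc_of_le h0, sub_zero]

theorem integrable_of_mem_Icc {Ω : Type*} [MeasurableSpace Ω] {μ : Measure Ω} [IsFiniteMeasure μ]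
    {f : Ω → ℝ} (hf : Measurable f) (h : ∀ ω, f ω ∈ Set.Icc (0 : ℝ) 1) : Integrable f μ :=
  Integrable.of_bound hf.aestronglyMeasurable 1 <| .of_forall fun ω => by
    rw [Real.norm_of_nonneg (h ω).1]
    exact (h ω).2

/-- Two functions on a product space have the same integral if they have the same integral over
some coordinate, whatever the values of the others. -/
theorem integral_pi_eq_of_integral_update_eq {ι : Type*} [Fintype ι] [DecidableEq ι]
    {X : ι → Type*} [∀ i, MeasurableSpace (X i)] {μ : ∀ i, Measure (X i)}
    [∀ i, IsProbabilityMeasure (μ i)] {f g : (∀ i, X i) → ℝ} (hf : Measurable f)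
    (hg : Measurable g) (hf' : ∀ t, f t ∈ Set.Icc (0 : ℝ) 1) (hg' : ∀ t, g t ∈ Set.Icc (0 : ℝ) 1)
    (i : ι) (h : ∀ t, ∫ s, f (Function.update t i s) ∂μ i = ∫ s, g (Function.update t i s) ∂μ i) :
    ∫ t, f t ∂Measure.pi μ = ∫ t, g t ∂Measure.pi μ := by
  have hne : Nonempty (∀ i, X i) := (Measure.pi μ).nonempty_of_neZero
  obtain ⟨t₀⟩ := hne
  have hlint : ∫⁻ t, ENNReal.ofReal (f t) ∂Measure.pi μ =
      ∫⁻ t, ENNReal.ofReal (g t) ∂Measure.pi μ := by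
    -- Tonelli with coordinate `i` integrated innermost; the base point `t₀` has no effect once all
    -- coordinates are integrated.
    rw [lintegral_eq_lmarginal_univ t₀, lintegral_eq_lmarginal_univ t₀,
      lmarginal_erase' _ hf.ennreal_ofReal (Finset.mem_univ i),
      lmarginal_erase' _ hg.ennreal_ofReal (Finset.mem_univ i)]
    congr 2 with t
    rw [← ofReal_integral_eq_lintegral_ofReal, ← ofReal_integral_eq_lintegral_ofReal, h]
    · exact integrable_of_mem_Icc (hg.comp (measurable_update t)) fun s => hg' _
    · exact .of_forall fun s => (hg' _).1
    · exact integrable_of_mem_Icc (hf.comp (measurable_update t)) fun s => hf' _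
    · exact .of_forall fun s => (hf' _).1
  rw [integral_eq_lintegral_of_nonneg_ae (.of_forall fun t => (hf' t).1) hf.aestronglyMeasurable,
    integral_eq_lintegral_of_nonneg_ae (.of_forall fun t => (hg' t).1) hg.aestronglyMeasurable,
    hlint]

/-- Numbers with sum at most one are the lengths of disjoint subsets of the unit interval. -/
theorem exists_sets_measure_biUnion_eq_sum {V : Type*} [Fintype V] {b : V → ℝ}
    (hb : ∀ u, 0 ≤ b u) (hsum : ∑ u, b u ≤ 1) :
    ∃ I : V → Set ℝ, (∀ u, MeasurableSet (I u)) ∧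
      ∀ A : Finset V, unitUniform.real (⋃ u ∈ A, I u) = ∑ u ∈ A, b u := by
  classical
  -- Intervals are laid end to end: those of `T` lie in `(0, σ]`, and a new element receives `(σ, b
  -- a + σ]`.
  have key : ∀ T : Finset V, ∃ I : V → Set ℝ, (∀ u, MeasurableSet (I u)) ∧
      (∀ u, I u ⊆ Set.Ioc 0 (∑ u ∈ T, b u)) ∧ Pairwise (Function.onFun Disjoint I) ∧
      ∀ u ∈ T, volume.real (I u) = b u := by
    intro T
    induction T using Finset.induction_on with
    | empty => exact ⟨fun _ => ∅, by simp, by simp, fun _ _ _ => disjoint_bot_left, by simp⟩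
    | insert a T ha ih =>
      obtain ⟨I, hm, hs, hd, hv⟩ := ih
      rw [Finset.sum_insert ha]
      set σ := ∑ u ∈ T, b u
      have hσ : 0 ≤ σ := Finset.sum_nonneg fun u _ => hb u
      have hdis : ∀ u, Disjoint (Set.Ioc σ (b a + σ)) (I u) := fun u =>
        (Set.disjoint_left.2 fun s h1 h2 => absurd h2.2 (not_le.2 h1.1)).mono_right (hs u)
      refine ⟨Function.update I a (Set.Ioc σ (b a + σ)), fun u => ?_, fun u => ?_,
        fun u u' hne => ?_, fun u hu => ?_⟩
      · rcases eq_or_ne u a with rfl | h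
        · rw [Function.update_self]
          exact measurableSet_Ioc
        · rw [Function.update_of_ne h]
          exact hm u
      · rcases eq_or_ne u a with rfl | h
        · rw [Function.update_self]
          exact Set.Ioc_subset_Ioc_left hσ
        · rw [Function.update_of_ne h]
          exact (hs u).trans (Set.Ioc_subset_Ioc_right (by linarith [hb a]))
      · rcases eq_or_ne u a with rfl | h
        · rw [Function.onFun, Function.update_self, Function.update_of_ne hne.symm]
          exact hdis u'
        · rcases eq_or_ne u' a with rfl | h'
          · rw [Function.onFun, Function.update_self, Function.update_of_ne h]
            exact (hdis u).symm
          · rw [Function.onFun, Function.update_of_ne h, Function.update_of_ne h']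
            exact hd hne
      · rcases eq_or_ne u a with rfl | h
        · rw [Function.update_self, Real.volume_real_Ioc_of_le (by linarith [hb u])]
          ring
        · rw [Function.update_of_ne h]
          exact hv u (Finset.mem_of_mem_insert_of_ne hu h)
  obtain ⟨I, hm, hs, hd, hv⟩ := key Finset.univ
  refine ⟨I, hm, fun A => ?_⟩
  rw [measureReal_biUnion_finset (fun u _ u' _ hne => hd hne) fun u _ => hm u]
  refine Finset.sum_congr rfl fun u _ => ?_
  rw [measureReal_restrict_apply (hm u), Set.inter_eq_left.2, hv u (Finset.mem_univ u)]
  exact (hs u).trans fun s h => ⟨h.1.le, h.2.trans hsum⟩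

/-! ### Random rules with prescribed activation probabilities. -/

/-- A family of random activation rules, monotone and measurable in the threshold, such that the
set `A` activates `v` with probability `w v A`. -/
structure IsRandomRule {V : Type*} (φ : V → ℝ → Finset V → Prop) (w : V → Finset V → ℝ) :
    Prop where
  mono : ∀ v s, Monotone (φ v s)
  measurableSet : ∀ v A, MeasurableSet {s | φ v s A}
  prob : ∀ v A, unitUniform.real {s | φ v s A} = w v A

/-- There are finitely many deterministic rules on a finite `V`, so every functional `Ψ` of the rule
is measurable. -/
theorem IsRandomRule.measurable_comp {V : Type*} [Fintype V] {φ : V → ℝ → Finset V → Prop}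
    {w : V → Finset V → ℝ} (hφ : IsRandomRule φ w)
    (Ψ : (V → Finset V → Prop) → ℝ) : Measurable fun t : V → ℝ => Ψ fun x => φ x (t x) := by
  refine (Measurable.of_discrete (f := Ψ)).comp ?_
  refine measurable_pi_lambda _ fun x => measurable_pi_lambda _ fun A => ?_
  exact (measurableSet_setOfPred.1 (hφ.measurableSet x A)).comp (measurable_pi_apply x)

section RandomRule

variable {V : Type*} [Fintype V] [DecidableEq V] {φ ψ : V → ℝ → Finset V → Prop}
  {w : V → Finset V → ℝ}

/-- The closures of `A` without and with an activation of `v` from outside. -/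
noncomputable def closurePair (v : V) (A : Finset V) (ρ : V → Finset V → Prop) :
    Finset V × Finset V :=
  (activationClosure (Function.update ρ v ⊥) A, activationClosure (Function.update ρ v ⊤) A)

theorem monotone_rule_bot {V : Type*} : Monotone (⊥ : Finset V → Prop) :=
  monotone_const

theorem monotone_rule_top {V : Type*} : Monotone (⊤ : Finset V → Prop) :=
  monotone_const

/-- The closures with `x` blocked are nested, so a monotone rule at `x` has three outcomes: it fires
at neither, only at the larger, or at both. Their probabilities are determined by `w`, so the
right-hand side does not mention `φ`. -/
theorem IsRandomRule.integral_closurePair_update (hφ : IsRandomRule φ w)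
    (Φ : Finset V × Finset V → ℝ)
    (v : V) (A : Finset V) {ρ : V → Finset V → Prop} (hρ : ∀ y, Monotone (ρ y)) {x : V}
    (hx : x ≠ v) :
    ∫ s, Φ (closurePair v A (Function.update ρ x (φ x s))) ∂unitUniform =
      Φ (closurePair v A (Function.update ρ x ⊥)) +
      w x (closurePair v A (Function.update ρ x ⊥)).2 *
        (Φ ((closurePair v A (Function.update ρ x ⊥)).1,
            (closurePair v A (Function.update ρ x ⊤)).2) -
          Φ (closurePair v A (Function.update ρ x ⊥))) +
      w x (closurePair v A (Function.update ρ x ⊥)).1 *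
        (Φ (closurePair v A (Function.update ρ x ⊤)) -
          Φ ((closurePair v A (Function.update ρ x ⊥)).1,
            (closurePair v A (Function.update ρ x ⊤)).2)) := by
  classical
  set T := closurePair v A (Function.update ρ x ⊥) with hT
  set T' := closurePair v A (Function.update ρ x ⊤) with hT'
  have hsub : T.1 ⊆ T.2 := activationClosure_mono (update_rule_le fun _ h => h.elim) le_rfl
  have hpair : ∀ s, closurePair v A (Function.update ρ x (φ x s)) =
      (if φ x s T.1 then T'.1 else T.1, if φ x s T.2 then T'.2 else T.2) := by
    intro s
    simp only [hT, hT', closurePair, Function.update_comm hx]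
    rw [activationClosure_update (monotone_update_rule hρ monotone_rule_bot) x (hφ.mono x s),
      activationClosure_update (monotone_update_rule hρ monotone_rule_top) x (hφ.mono x s)]
  have hfun : (fun s => Φ (closurePair v A (Function.update ρ x (φ x s)))) =
      (fun _ => Φ T) + {s | φ x s T.2}.indicator (fun _ => Φ (T.1, T'.2) - Φ T) +
        {s | φ x s T.1}.indicator (fun _ => Φ T' - Φ (T.1, T'.2)) := by
    funext s
    rw [hpair]
    by_cases h1 : φ x s T.1
    · have h2 : φ x s T.2 := hφ.mono x s hsub h1
      simp [Set.indicator, h1, h2]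
    · by_cases h2 : φ x s T.2 <;> simp [Set.indicator, h1, h2]
  have hint : ∀ (S : Finset V) (c : ℝ),
      Integrable ({s | φ x s S}.indicator fun _ => c) unitUniform := fun S c =>
    (integrable_const c).indicator (hφ.measurableSet x S)
  rw [hfun, integral_add' ((integrable_const _).add (hint _ _)) (hint _ _),
    integral_add' (integrable_const _) (hint _ _), integral_const,
    integral_indicator_const _ (hφ.measurableSet x _),
    integral_indicator_const _ (hφ.measurableSet x _), hφ.prob, hφ.prob]
  simp

/-- The joint law of the two closures depends only on the activation probabilities. -/
theorem IsRandomRule.integral_closurePair_eq (hφ : IsRandomRule φ w) (hψ : IsRandomRule ψ w)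
    {Φ : Finset V × Finset V → ℝ} (hΦ : ∀ p, Φ p ∈ Set.Icc (0 : ℝ) 1) (v : V) (A : Finset V) :
    ∫ t, Φ (closurePair v A fun x => φ x (t x)) ∂thresholdLaw V =
      ∫ t, Φ (closurePair v A fun x => ψ x (t x)) ∂thresholdLaw V := by
  classical
  have hmix : ∀ T : Finset V, IsRandomRule (fun x => if x ∈ T then ψ x else φ x) w := by
    intro T
    refine ⟨fun x => ?_, fun x => ?_, fun x => ?_⟩ <;> by_cases h : x ∈ T <;>
      simp only [h, if_true, if_false]
    exacts [hψ.mono x, hφ.mono x, hψ.measurableSet x, hφ.measurableSet x, hψ.prob x, hφ.prob x]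
  -- Hybrid argument: the rules are exchanged one node at a time, `T` being the nodes already
  -- exchanged.
  have key : ∀ T : Finset V, ∫ t, Φ (closurePair v A fun x => φ x (t x)) ∂thresholdLaw V =
      ∫ t, Φ (closurePair v A fun x => (if x ∈ T then ψ x else φ x) (t x)) ∂thresholdLaw V := by
    intro T
    induction T using Finset.induction_on with
    | empty => simp
    | insert a T ha ih =>
      rw [ih]
      refine integral_pi_eq_of_integral_update_eq
        ((hmix T).measurable_comp fun ρ => Φ (closurePair v A ρ))
        ((hmix (insert a T)).measurable_comp fun ρ => Φ (closurePair v A ρ))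
        (fun _ => hΦ _) (fun _ => hΦ _) a fun t => ?_
      have h1 : ∀ s, (fun x => (if x ∈ T then ψ x else φ x) (Function.update t a s x)) =
          Function.update (fun x => (if x ∈ T then ψ x else φ x) (t x)) a (φ a s) := by
        intro s
        funext x
        rcases eq_or_ne x a with rfl | h
        · simp [ha]
        · simp [h]
      have h2 : ∀ s, (fun x => (if x ∈ insert a T then ψ x else φ x) (Function.update t a s x)) =
          Function.update (fun x => (if x ∈ T then ψ x else φ x) (t x)) a (ψ a s) := by
        intro s
        funext x
        rcases eq_or_ne x a with rfl | h
        · simp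
        · simp [h]
      simp only [h1, h2]
      -- The rule of `v` itself is overwritten in both closures, so exchanging it changes nothing.
      rcases eq_or_ne a v with rfl | hav
      · simp [closurePair]
      · rw [hφ.integral_closurePair_update Φ v A (fun y => (hmix T).mono y _) hav,
          hψ.integral_closurePair_update Φ v A (fun y => (hmix T).mono y _) hav]
  simpa using key Finset.univ

end RandomRule

/-! ### The probability that a threshold is at most a multiple of the final influence. -/

namespace InfluenceGraph

variable {V : Type*} [Fintype V] [DecidableEq V] (G : InfluenceGraph V)

theorem isRandomRule_threshold :
    IsRandomRule (fun v s A => s ≤ G.influence A v) fun v A => G.influence A v where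
  mono v _ _ _ h hA := le_trans (b := G.influence _ v) hA (G.influence_mono h v)
  measurableSet _ _ := measurableSet_Iic
  prob v A := unitUniform_real_setOf_le (G.influence_nonneg A v) (G.influence_le_one A v)

/-- The live-edge model: additive random rules with the activation probabilities of the Linear
Threshold Model. -/
theorem exists_additive_randomRule : ∃ ψ : V → ℝ → Finset V → Prop,
    IsRandomRule ψ (fun v A => G.influence A v) ∧
      ∀ v s A B, ψ v s (A ∪ B) ↔ ψ v s A ∨ ψ v s B := by
  -- A sample in `I v u` makes the edge from `u` to `v` live, and `v` fires when a live edge comes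
  -- from an active node.
  have hI := fun v => exists_sets_measure_biUnion_eq_sum (b := fun u => G.edgeWeight u v)
    (fun u => G.edgeWeight_nonneg u v)
    (by rw [← G.influence_eq_sum]; exact G.influence_le_one _ v)
  choose I hm hI using hI
  have hset : ∀ v (A : Finset V), {s | ∃ u ∈ A, s ∈ I v u} = ⋃ u ∈ A, I v u := by
    intro v A
    ext s
    simp
  refine ⟨fun v s A => ∃ u ∈ A, s ∈ I v u, ⟨fun v s A B h => ?_, fun v A => ?_, fun v A => ?_⟩,
    fun v s A B => ?_⟩
  · rintro ⟨u, hu, hs⟩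
    exact ⟨u, h hu, hs⟩
  · rw [hset]
    exact A.measurableSet_biUnion fun u _ => hm v u
  · rw [hset, hI, G.influence_eq_sum]
  · simp only [Finset.mem_union, or_and_right, exists_or]

/-- The probability that the threshold of `v` is at most `β` times the final influence on `v`,
given the active sets of the other nodes without and with an activation of `v`. -/
noncomputable def conditionalProb (β : ℝ) (v : V) (A : Finset V) (p : Finset V × Finset V) : ℝ :=
  if v ∈ A then β * G.influence p.2 v else min (G.influence p.1 v) (β * G.influence p.2 v)

variable {β : ℝ}

theorem conditionalProb_mem_Icc (hβ : β ∈ Set.Icc (0 : ℝ) 1) (v : V) (A : Finset V)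
    (p : Finset V × Finset V) : G.conditionalProb β v A p ∈ Set.Icc (0 : ℝ) 1 := by
  have h0 : 0 ≤ β * G.influence p.2 v := mul_nonneg hβ.1 (G.influence_nonneg _ v)
  have h1 : β * G.influence p.2 v ≤ 1 :=
    mul_le_one₀ hβ.2 (G.influence_nonneg _ v) (G.influence_le_one _ v)
  unfold conditionalProb
  split_ifs
  · exact ⟨h0, h1⟩
  · exact ⟨le_min (G.influence_nonneg _ v) h0, (min_le_right _ _).trans h1⟩

/-- The larger closure is `X A ∪ Y` with `Y` independent of `A`. Splitting the influence of `X A`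
into the part `P` outside `Y` and the part `Q` inside turns the minimum of `P + Q` and `β * P + c`
into `β * P + min ((1 - β) * P + Q) c`: coverage functions and a truncation. -/
theorem isMonotoneSubmodular_conditionalProb (hβ : β ∈ Set.Icc (0 : ℝ) 1) (v : V)
    {ρ : V → Finset V → Prop} (hρ : ∀ y A B, ρ y (A ∪ B) ↔ ρ y A ∨ ρ y B) :
    IsMonotoneSubmodular fun A => G.conditionalProb β v A (closurePair v A ρ) := by
  set X : Finset V → Finset V := activationClosure (Function.update ρ v ⊥)
  set Y : Finset V := activationClosure (Function.update ρ v ⊤) ∅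
  set e : V → ℝ := fun u => G.edgeWeight u v
  have he : ∀ u, 0 ≤ e u := fun u => G.edgeWeight_nonneg u v
  set c : ℝ := β * ∑ u ∈ Y, e u
  have hc : 0 ≤ c := mul_nonneg hβ.1 (Finset.sum_nonneg fun u _ => he u)
  have hX : ∀ A B, X (A ∪ B) = X A ∪ X B := by
    refine activationClosure_union fun y A B => ?_
    rcases eq_or_ne y v with rfl | h
    · simp
    · simp only [Function.update_of_ne h]
      exact hρ y A B
  set P : Finset V → ℝ := fun A => ∑ u ∈ X A, if u ∈ Y then 0 else e u with hP
  set Q : Finset V → ℝ := fun A => ∑ u ∈ X A, if u ∈ Y then e u else 0 with hQ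
  -- `R` equals `c` when `v` is a seed, which saturates the truncation and so covers the seed case
  -- with the same formula.
  set R : Finset V → ℝ := fun A => ∑ u ∈ A, if u = v then c else 0 with hR
  have hPm : IsMonotoneSubmodular P := .coverage hX fun u => by
    split_ifs
    exacts [le_rfl, he u]
  have hQm : IsMonotoneSubmodular Q := .coverage hX fun u => by
    split_ifs
    exacts [he u, le_rfl]
  have hRm : IsMonotoneSubmodular R := .coverage (X := id) (fun _ _ => rfl) fun u => by
    split_ifs
    exacts [hc, le_rfl]
  have hP0 : ∀ A, 0 ≤ P A := fun A => Finset.sum_nonneg fun u _ => by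
    split_ifs
    exacts [le_rfl, he u]
  have hQ0 : ∀ A, 0 ≤ Q A := fun A => Finset.sum_nonneg fun u _ => by
    split_ifs
    exacts [he u, le_rfl]
  have hPQ : ∀ A, G.influence (X A) v = P A + Q A := by
    intro A
    rw [influence_eq_sum, hP, hQ, ← Finset.sum_add_distrib]
    refine Finset.sum_congr rfl fun u _ => ?_
    split_ifs <;> simp [e]
  have hPY : ∀ A, G.influence (X A ∪ Y) v = P A + ∑ u ∈ Y, e u := by
    intro A
    rw [influence_eq_sum, ← Finset.sdiff_union_self_eq_union,
      Finset.sum_union Finset.sdiff_disjoint, hP, ← Finset.filter_notMem_eq_sdiff,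
      Finset.sum_filter]
    simp only [ite_not, e]
  have hmain : (fun A => G.conditionalProb β v A (closurePair v A ρ)) =
      fun A => β * P A + min ((1 - β) * P A + Q A + R A) c := by
    funext A
    have hsnd : (closurePair v A ρ).2 = X A ∪ Y := activationClosure_update_top_eq_union hρ v A
    have hfst : (closurePair v A ρ).1 = X A := rfl
    have hq : 0 ≤ (1 - β) * P A := mul_nonneg (by linarith [hβ.2]) (hP0 A)
    have hRA : R A = if v ∈ A then c else 0 := Finset.sum_ite_eq' A v fun _ => c
    rw [conditionalProb, hsnd, hfst, hPQ, hPY, hRA, mul_add]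
    split_ifs
    · rw [min_eq_right (by linarith [hQ0 A])]
    · rw [← min_add_add_left]
      congr 1
      ring
  rw [hmain]
  exact (hPm.const_mul hβ.1).add
    ((((hPm.const_mul (by linarith [hβ.2])).add hQm).add hRm).min_const c)

theorem measurable_comp_thresholdRule (Ψ : (V → Finset V → Prop) → ℝ) :
    Measurable fun t => Ψ (G.thresholdRule t) :=
  G.isRandomRule_threshold.measurable_comp Ψ

theorem measurable_influence_finalActive (A : Finset V) (v : V) :
    Measurable fun t => G.influence (G.finalActive t A) v := by
  simp only [finalActive_eq_activationClosure]
  exact G.measurable_comp_thresholdRule fun ρ => G.influence (activationClosure ρ A) v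

theorem measurableSet_le_mul_influence (β : ℝ) (A : Finset V) (v : V) :
    MeasurableSet {t : V → ℝ | t v ≤ β * G.influence (G.finalActive t A) v} :=
  measurableSet_le (measurable_pi_apply v) ((G.measurable_influence_finalActive A v).const_mul β)

theorem finalActive_update (t : V → ℝ) (A : Finset V) (v : V) (s : ℝ) :
    G.finalActive (Function.update t v s) A =
      if s ≤ G.influence (closurePair v A (G.thresholdRule t)).1 v then
        (closurePair v A (G.thresholdRule t)).2 else (closurePair v A (G.thresholdRule t)).1 := by
  have hrule : G.thresholdRule (Function.update t v s) =
      Function.update (G.thresholdRule t) v fun S => s ≤ G.influence S v := by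
    funext x S
    rcases eq_or_ne x v with rfl | h
    · simp [thresholdRule]
    · simp [thresholdRule, h]
  rw [finalActive_eq_activationClosure, hrule]
  exact activationClosure_update (G.thresholdRule_mono t) v (G.isRandomRule_threshold.mono v s)

/-- As `β ≤ 1`, a threshold of at most `β` times the final influence forces `v` to be active, so for
a non-seed the event is activation of `v` together with the bound at the larger closure. -/
theorem le_mul_influence_update_iff (hβ : β ∈ Set.Icc (0 : ℝ) 1) (t : V → ℝ) (A : Finset V)
    (v : V) (s : ℝ) :
    s ≤ β * G.influence (G.finalActive (Function.update t v s) A) v ↔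
      s ≤ G.conditionalProb β v A (closurePair v A (G.thresholdRule t)) := by
  classical
  rw [G.finalActive_update, conditionalProb]
  set p := closurePair v A (G.thresholdRule t) with hp
  have hsub : p.1 ⊆ p.2 := activationClosure_mono (update_rule_le fun _ h => h.elim) le_rfl
  have hle : ∀ S, β * G.influence S v ≤ G.influence S v := fun S =>
    mul_le_of_le_one_left (G.influence_nonneg S v) hβ.2
  by_cases hv : v ∈ A
  · have heq : p.1 = p.2 := by
      refine hsub.antisymm (activationClosure_subset subset_activationClosure fun y hy => ?_)
      rcases eq_or_ne y v with rfl | h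
      · exact subset_activationClosure hv
      · refine activationClosure_closed
          (monotone_update_rule (G.thresholdRule_mono t) monotone_rule_bot) y ?_
        rwa [Function.update_of_ne h] at hy ⊢
    simp only [hv, if_true, heq, ite_self]
  · simp only [hv, if_false, le_min_iff]
    split_ifs with h
    · exact ⟨fun h' => ⟨h, h'⟩, fun h' => h'.2⟩
    · exact ⟨fun h' => absurd (h'.trans (hle _)) h, fun h' => absurd h'.1 h⟩

theorem real_setOf_le_mul_influence (hβ : β ∈ Set.Icc (0 : ℝ) 1) (A : Finset V) (v : V) :
    (thresholdLaw V).real {t | t v ≤ β * G.influence (G.finalActive t A) v} =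
      ∫ t, G.conditionalProb β v A (closurePair v A (G.thresholdRule t)) ∂thresholdLaw V := by
  have hmeas := G.measurableSet_le_mul_influence β A v
  rw [← integral_indicator_one hmeas]
  refine integral_pi_eq_of_integral_update_eq (measurable_one.indicator hmeas)
    (G.measurable_comp_thresholdRule fun ρ => G.conditionalProb β v A (closurePair v A ρ))
    (fun t => ?_) (fun t => G.conditionalProb_mem_Icc hβ v A _) v fun t => ?_
  · by_cases h : t ∈ {t | t v ≤ β * G.influence (G.finalActive t A) v}
    · simp [Set.indicator_of_mem h]
    · simp [Set.indicator_of_notMem h]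
  · have hpair : ∀ s, closurePair v A (G.thresholdRule (Function.update t v s)) =
        closurePair v A (G.thresholdRule t) := by
      intro s
      have hrule : ∀ r, Function.update (G.thresholdRule (Function.update t v s)) v r =
          Function.update (G.thresholdRule t) v r := by
        intro r
        funext x
        rcases eq_or_ne x v with rfl | h
        · simp
        · funext S
          simp [thresholdRule, h]
      simp only [closurePair, hrule]
    set m := G.conditionalProb β v A (closurePair v A (G.thresholdRule t)) with hm
    have hind : (fun s => {t : V → ℝ | t v ≤ β * G.influence (G.finalActive t A) v}.indicator
        (1 : (V → ℝ) → ℝ) (Function.update t v s)) = {s : ℝ | s ≤ m}.indicator 1 := by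
      funext s
      simp only [Set.indicator, Set.mem_ofPred_eq, Function.update_self,
        G.le_mul_influence_update_iff hβ, Pi.one_apply, hm]
    have hmem := G.conditionalProb_mem_Icc hβ v A (closurePair v A (G.thresholdRule t))
    simp only [hpair]
    have hset : MeasurableSet {s : ℝ | s ≤ m} := measurableSet_Iic
    rw [hind, integral_indicator_one hset, integral_const,
      unitUniform_real_setOf_le hmem.1 hmem.2]
    simp

/-- For fixed thresholds the process need not be submodular; passing to live edges preserves the
expectation and makes every sample submodular. -/
theorem isMonotoneSubmodular_real_setOf_le_mul_influence (hβ : β ∈ Set.Icc (0 : ℝ) 1) (v : V) :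
    IsMonotoneSubmodular fun A =>
      (thresholdLaw V).real {t | t v ≤ β * G.influence (G.finalActive t A) v} := by
  obtain ⟨ψ, hψ, hadd⟩ := G.exists_additive_randomRule
  have heq : ∀ A, (thresholdLaw V).real {t | t v ≤ β * G.influence (G.finalActive t A) v} =
      ∫ t, G.conditionalProb β v A (closurePair v A fun x => ψ x (t x)) ∂thresholdLaw V := by
    intro A
    rw [G.real_setOf_le_mul_influence hβ]
    exact G.isRandomRule_threshold.integral_closurePair_eq hψ
      (G.conditionalProb_mem_Icc hβ v A) v A
  simp only [heq]
  exact .integral (fun t => G.isMonotoneSubmodular_conditionalProb hβ v fun y => hadd y (t y))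
    fun A => integrable_of_mem_Icc
      (hψ.measurable_comp fun ρ => G.conditionalProb β v A (closurePair v A ρ))
      fun t => G.conditionalProb_mem_Icc hβ v A _

end InfluenceGraph

/-! ### The expected score of the target candidate. -/

theorem thresholdLaw_ae_pos (V : Type*) [Fintype V] (v : V) : ∀ᵐ t ∂thresholdLaw V, 0 < t v := by
  have h : ∀ᵐ s ∂unitUniform, 0 < s := by
    filter_upwards [ae_restrict_mem measurableSet_Icc,
      (Measure.ae_ne (volume.restrict (Set.Icc (0 : ℝ) 1)) 0)] with s hs hs0
    exact lt_of_le_of_ne hs.1 hs0.symm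
  exact (measurePreserving_eval (fun _ : V => unitUniform) v).quasiMeasurePreserving.ae h

/-- Telescoping along the `k` places climbed, with the sum extended to all `r` places by indicators.
-/
theorem cast_apply_sub_eq_add_sum {m : ℕ} {f : Fin m → ℕ} (r : Fin m) {k : ℕ} (hk : k ≤ r) :
    (f ⟨r - k, (Nat.sub_le _ _).trans_lt r.isLt⟩ : ℝ) =
      f r + ∑ j : Fin r, ((f ⟨r - (j + 1), (Nat.sub_le _ _).trans_lt r.isLt⟩ : ℝ) -
        f ⟨r - j, (Nat.sub_le _ _).trans_lt r.isLt⟩) * if (j : ℕ) + 1 ≤ k then 1 else 0 := by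
  rw [Fin.sum_univ_eq_sum_range (fun j => ((f ⟨r - (j + 1), (Nat.sub_le _ _).trans_lt r.isLt⟩ : ℝ) -
        f ⟨r - j, (Nat.sub_le _ _).trans_lt r.isLt⟩) * if j + 1 ≤ k then 1 else 0) (r : ℕ)]
  simp only [mul_ite, mul_one, mul_zero, ← Finset.sum_filter, Nat.add_one_le_iff]
  have : (Finset.range r).filter (fun j => j < k) = Finset.range k := by
    ext j
    simp only [Finset.mem_filter, Finset.mem_range]
    omega
  rw [this, Finset.sum_range_sub
    (fun j => (f ⟨r - j, (Nat.sub_le _ _).trans_lt r.isLt⟩ : ℝ)) k]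
  simp

namespace Election

variable {V C : Type*} [Fintype V] [DecidableEq V] [Fintype C] (P : Election V C)

theorem shiftUp_le (t : V → ℝ) (A : Finset V) (v : V) :
    P.shiftUp t A v ≤ (P.pref v P.target : ℕ) :=
  min_le_left _ _

/-- Clearing the floor and exchanging `t v` with `j + 1` turns a climb of at least `j + 1` places
into a threshold event with `β = α / (j + 1)`. -/
theorem succ_le_shiftUp_iff {t : V → ℝ} (A : Finset V) {v : V} (ht : 0 < t v) {j : ℕ}
    (hj : j < (P.pref v P.target : ℕ)) :
    j + 1 ≤ P.shiftUp t A v ↔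
      t v ≤ P.rate (P.pref v P.target) / ((j : ℝ) + 1) *
        P.graph.influence (P.graph.finalActive t A) v := by
  have hj' : (0 : ℝ) < j + 1 := by positivity
  rw [shiftUp, le_min_iff, and_iff_right (Nat.succ_le_of_lt hj),
    Nat.le_floor_iff' (Nat.succ_ne_zero j),
    div_mul_eq_mul_div, div_mul_eq_mul_div, le_div_iff₀ ht, le_div_iff₀ hj', mul_comm]
  push_cast
  rfl

theorem measurable_shiftUp (A : Finset V) : Measurable fun t => P.shiftUp t A := by
  refine measurable_pi_lambda _ fun v => ?_
  refine measurable_const.min (Measurable.nat_floor ?_)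
  exact (measurable_const.div (measurable_pi_apply v)).mul
    (P.graph.measurable_influence_finalActive A v)

theorem newTargetPos_le (t : V → ℝ) (A : Finset V) (v : V) :
    P.newTargetPos t A v ≤ P.pref v P.target :=
  Fin.mk_le_of_le_val (Nat.sub_le _ _)

variable [DecidableEq C]

theorem newPos_target (t : V → ℝ) (A : Finset V) (v : V) :
    P.newPos t A v P.target = P.newTargetPos t A v :=
  if_pos rfl

/-- Functions of the new positions are measurable. -/
theorem measurable_comp_newPos (A : Finset V) (Ψ : (V → C → Fin (Fintype.card C)) → ℝ) :
    Measurable fun t => Ψ (P.newPos t A) := by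
  -- The new positions depend on `t` only through the shifts, which live in a countable discrete
  -- space.
  have h : ∃ Ψ' : (V → ℕ) → ℝ, ∀ t, Ψ (P.newPos t A) = Ψ' (P.shiftUp t A) := by
    refine Function.factorsThrough_iff (f := fun t => P.shiftUp t A) _ |>.1 ?_ |>.imp
      fun Ψ' h t => congrFun h t
    intro t t' htt
    have hpos : P.newTargetPos t A = P.newTargetPos t' A := by
      funext v
      rw [newTargetPos, newTargetPos]
      simp only [congrFun htt v]
    have : P.newPos t A = P.newPos t' A := by
      funext v c
      simp only [newPos, hpos]
    simp only [this]
  obtain ⟨Ψ', h⟩ := h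
  simp only [h]
  exact (Measurable.of_discrete (f := Ψ')).comp (P.measurable_shiftUp A)

theorem integrable_comp_newPos (A : Finset V) (Ψ : (V → C → Fin (Fintype.card C)) → ℝ) :
    Integrable (fun t => Ψ (P.newPos t A)) (thresholdLaw V) := by
  obtain ⟨M, hM⟩ := (Set.finite_range fun pos => ‖Ψ pos‖).bddAbove
  exact Integrable.of_bound (P.measurable_comp_newPos A Ψ).aestronglyMeasurable M
    (.of_forall fun t => hM ⟨_, rfl⟩)

theorem isMonotoneSubmodular_expectedScore : IsMonotoneSubmodular P.expectedScore := by
  set pt : V → Fin (Fintype.card C) := fun v => P.pref v P.target with hpt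
  set δ : ∀ v, Fin (pt v) → ℝ := fun v j =>
    (P.scoring ⟨pt v - (j + 1), (Nat.sub_le _ _).trans_lt (pt v).isLt⟩ : ℝ) -
      P.scoring ⟨pt v - j, (Nat.sub_le _ _).trans_lt (pt v).isLt⟩ with hδ
  set β : ∀ v, Fin (pt v) → ℝ := fun v j => P.rate (pt v) / ((j : ℝ) + 1) with hβ
  set E : Finset V → ∀ v, Fin (pt v) → Set (V → ℝ) := fun A v j =>
    {t | t v ≤ β v j * P.graph.influence (P.graph.finalActive t A) v} with hE
  have hEm : ∀ A v j, MeasurableSet (E A v j) := fun A v j =>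
    P.graph.measurableSet_le_mul_influence _ A v
  have hδ0 : ∀ v j, 0 ≤ δ v j := fun v j => by
    rw [hδ, sub_nonneg]
    exact_mod_cast P.scoring_antitone (Fin.mk_le_mk.2 (by omega))
  have hβ1 : ∀ v j, β v j ∈ Set.Icc (0 : ℝ) 1 := fun v j => by
    have := P.rate_mem (pt v)
    have hj : (0 : ℝ) < j + 1 := by positivity
    refine ⟨div_nonneg this.1 hj.le, (div_le_one hj).2 (this.2.trans ?_)⟩
    linarith [Nat.cast_nonneg (α := ℝ) (j : ℕ)]
  have hscore : ∀ A, P.expectedScore A =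
      ∑ v, ((P.scoring (pt v) : ℝ) + ∑ j, δ v j * (thresholdLaw V).real (E A v j)) := by
    intro A
    have hae : (fun t => (P.score (P.newPos t A) P.target : ℝ)) =ᵐ[thresholdLaw V]
        fun t => ∑ v, ((P.scoring (pt v) : ℝ) + ∑ j, δ v j * (E A v j).indicator 1 t) := by
      filter_upwards [Filter.eventually_all.2 (thresholdLaw_ae_pos V)] with t ht
      rw [score, Nat.cast_sum]
      refine Finset.sum_congr rfl fun v _ => ?_
      rw [newPos_target, newTargetPos, cast_apply_sub_eq_add_sum _ (P.shiftUp_le t A v)]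
      congr 1
      refine Finset.sum_congr rfl fun j _ => ?_
      simp only [P.succ_le_shiftUp_iff A (ht v) j.isLt]
      rfl
    have hint : ∀ v j, Integrable (fun t => δ v j * (E A v j).indicator 1 t) (thresholdLaw V) :=
      fun v j => ((integrable_const (1 : ℝ)).indicator (hEm A v j)).const_mul _
    have hint' : ∀ v, Integrable (fun t => (P.scoring (pt v) : ℝ) +
        ∑ j, δ v j * (E A v j).indicator 1 t) (thresholdLaw V) := fun v =>
      (integrable_const _).add (integrable_finsetSum _ fun j _ => hint v j)
    rw [expectedScore, integral_congr_ae hae, integral_finsetSum _ fun v _ => hint' v]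
    refine Finset.sum_congr rfl fun v _ => ?_
    rw [integral_add (integrable_const _) (integrable_finsetSum _ fun j _ => hint v j),
      integral_finsetSum _ fun j _ => hint v j, integral_const]
    simp only [probReal_univ, one_smul, integral_const_mul, integral_indicator_one (hEm A v _)]
  have hfun : P.expectedScore = fun A =>
      ∑ v, ((P.scoring (pt v) : ℝ) + ∑ j, δ v j * (thresholdLaw V).real (E A v j)) := funext hscore
  rw [hfun]
  exact .sum _ fun v _ => (IsMonotoneSubmodular.const _).add <| .sum _ fun j _ =>
    (P.graph.isMonotoneSubmodular_real_setOf_le_mul_influence (hβ1 v j) v).const_mul (hδ0 v j)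

/-! ### Change in margin against score gain. -/

/-- The score that the target candidate gains. -/
noncomputable def scoreGain (pos : V → C → Fin (Fintype.card C)) : ℤ :=
  (P.score pos P.target : ℤ) - P.score (fun v c => P.pref v c) P.target

theorem pref_le_newPos (t : V → ℝ) (A : Finset V) (v : V) {c : C} (hc : c ≠ P.target) :
    P.pref v c ≤ P.newPos t A v c := by
  rw [newPos, if_neg hc]
  split_ifs
  · exact Fin.le_def.2 (Nat.le_succ _)
  · exact le_rfl

theorem score_newPos_le (t : V → ℝ) (A : Finset V) {c : C} (hc : c ≠ P.target) :
    P.score (P.newPos t A) c ≤ P.score (fun v c => P.pref v c) c :=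
  Finset.sum_le_sum fun v _ => P.scoring_antitone (P.pref_le_newPos t A v hc)

/-- No candidate loses more than the target candidate gains. -/
theorem score_pref_le (t : V → ℝ) (A : Finset V) {c : C} (hc : c ≠ P.target) :
    P.score (fun v c => P.pref v c) c + P.score (fun v c => P.pref v c) P.target ≤
      P.score (P.newPos t A) c + P.score (P.newPos t A) P.target := by
  simp only [score, ← Finset.sum_add_distrib]
  refine Finset.sum_le_sum fun v _ => ?_
  rw [newPos_target]
  have hle := P.scoring_antitone (P.newTargetPos_le t A v)
  rw [newPos, if_neg hc]
  -- An overtaken candidate drops one place, to no lower than the target's old place, while the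
  -- target lands no lower than that candidate's old place; hence the loss is at most the target's
  -- gain in this list.
  split_ifs with h
  · have h1 := P.scoring_antitone h.1
    have h2 : P.scoring (P.pref v P.target) ≤
        P.scoring ⟨(P.pref v c : ℕ) + 1, lt_of_le_of_lt (Nat.succ_le_of_lt h.2)
          (P.pref v P.target).isLt⟩ :=
      P.scoring_antitone (Fin.mk_le_of_le_val (Nat.succ_le_of_lt h.2))
    omega
  · omega

theorem scoreGain_nonneg (t : V → ℝ) (A : Finset V) : 0 ≤ P.scoreGain (P.newPos t A) := by
  rw [scoreGain, sub_nonneg, Nat.cast_le]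
  refine Finset.sum_le_sum fun v _ => P.scoring_antitone ?_
  rw [newPos_target]
  exact P.newTargetPos_le t A v

/-- No rival's score increases, so the best rival score can only help the margin. -/
theorem scoreGain_le_mov (t : V → ℝ) (A : Finset V) : P.scoreGain (P.newPos t A) ≤ P.mov t A := by
  have h : (Finset.univ.erase P.target).sup (P.score (P.newPos t A)) ≤
      (Finset.univ.erase P.target).sup (P.score fun v c => P.pref v c) :=
    Finset.sup_mono_fun fun c hc => P.score_newPos_le t A (Finset.ne_of_mem_erase hc)
  rw [scoreGain, mov, margin, margin]
  omega

/-- The gain counts twice: once for the target itself and once as a bound on the drop of the best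
rival score. -/
theorem mov_le (t : V → ℝ) (A : Finset V) : P.mov t A ≤ 2 * P.scoreGain (P.newPos t A) := by
  have hD := P.scoreGain_nonneg t A
  have h : (Finset.univ.erase P.target).sup (P.score fun v c => P.pref v c) ≤
      (Finset.univ.erase P.target).sup (P.score (P.newPos t A)) +
        (P.scoreGain (P.newPos t A)).toNat := by
    refine Finset.sup_le fun c hc => ?_
    have h1 := P.score_pref_le t A (Finset.ne_of_mem_erase hc)
    have h2 := Finset.le_sup (f := P.score (P.newPos t A)) hc
    rw [scoreGain] at hD ⊢
    omega
  rw [mov, margin, margin]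
  rw [scoreGain] at h hD ⊢
  omega

/-- The expected gain in score of the target candidate is a lower bound for the expected change in
margin, and twice the gain is an upper bound. -/
theorem expectedMov_mem_Icc (A : Finset V) :
    P.expectedMov A ∈
      Set.Icc (P.expectedScore A - P.score (fun v c => P.pref v c) P.target)
        (2 * (P.expectedScore A - P.score (fun v c => P.pref v c) P.target)) := by
  have hgain : P.expectedScore A - P.score (fun v c => P.pref v c) P.target =
      ∫ t, (P.scoreGain (P.newPos t A) : ℝ) ∂thresholdLaw V := by
    simp only [scoreGain, Int.cast_sub, Int.cast_natCast]
    rw [integral_sub (P.integrable_comp_newPos A fun pos => (P.score pos P.target : ℝ))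
      (integrable_const _), integral_const]
    simp [expectedScore]
  have hD := P.integrable_comp_newPos A fun pos => (P.scoreGain pos : ℝ)
  have hM : Integrable (fun t => (P.mov t A : ℝ)) (thresholdLaw V) :=
    P.integrable_comp_newPos A fun pos =>
      ((P.margin (fun v c => P.pref v c) - P.margin pos : ℤ) : ℝ)
  rw [hgain, expectedMov, ← integral_const_mul]
  exact ⟨integral_mono hD hM fun t => Int.cast_le.2 (P.scoreGain_le_mov t A),
    integral_mono hM (hD.const_mul 2) fun t =>
      (Int.cast_le.2 (P.mov_le t A)).trans_eq (by push_cast; rfl)⟩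

end Election

/-! ### The approximation guarantee. -/

theorem mainTheorem1 {V C : Type*} [Fintype V] [DecidableEq V] [Fintype C] [DecidableEq C]
    [Nontrivial C] (P : Election V C) (B : ℕ) :
    (∃ A, IsGreedyOutput P.expectedScore B A) ∧
    ∀ A, IsGreedyOutput P.expectedScore B A →
      A.card ≤ B ∧
      ∀ A' : Finset V, A'.card ≤ B →
        (1 / 3) * (1 - 1 / Real.exp 1) * P.expectedMov A' ≤ P.expectedMov A := by
  refine ⟨exists_isGreedyOutput _ B, fun A hA => ⟨hA.1.card_le, fun A' hA' => ?_⟩⟩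
  have happrox := P.isMonotoneSubmodular_expectedScore.greedy_approximation hA' hA
  set F₀ : ℝ := Nat.cast (P.score (fun v c => P.pref v c) P.target)
  obtain ⟨hlow, -⟩ := P.expectedMov_mem_Icc A
  obtain ⟨hlow', hup'⟩ := P.expectedMov_mem_Icc A'
  obtain ⟨hlow₀, hup₀⟩ := P.expectedMov_mem_Icc ∅
  have hq : 0 ≤ 1 - 1 / Real.exp 1 := by
    rw [sub_nonneg, div_le_one (Real.exp_pos 1)]
    exact Real.one_le_exp zero_le_one
  have hq1 : 1 - 1 / Real.exp 1 ≤ 1 := sub_le_self 1 (by positivity)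
  calc (1 / 3) * (1 - 1 / Real.exp 1) * P.expectedMov A'
      ≤ (1 - 1 / Real.exp 1) * (P.expectedScore A' - F₀) := by
        rw [mul_comm (1 / 3 : ℝ), mul_assoc]
        -- The bounds `gain ≤ MoV ≤ 2 * gain` force `gain ≥ 0`, so `MoV ≤ 3 * gain`; the constant `1
        -- / 2` would do as well.
        exact mul_le_mul_of_nonneg_left (by linarith) hq
    _ = (1 - 1 / Real.exp 1) * (P.expectedScore A' - P.expectedScore ∅) +
          (1 - 1 / Real.exp 1) * (P.expectedScore ∅ - F₀) := by ring
    -- Greedy measures gains from `P.expectedScore ∅`, the margin from `F₀`; only nonnegativity of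
    -- their difference is needed.
    _ ≤ (P.expectedScore A - P.expectedScore ∅) + (P.expectedScore ∅ - F₀) :=
        add_le_add happrox (mul_le_of_le_one_left (by linarith) hq1)
    _ ≤ P.expectedMov A := by linarith
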